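/- Let $k\ge 2$ be an integer. A $k$-uniform hypergraph $\mathcal H=(V,E)$ on $n$ vertices consists of a vertex set $V$ with $|V|=n$ and a set $E$ of $k$-element subsets of $V$ (the hyperedges). For $t\ge 2$, a Berge-$P_t$ in $\mathcal H$ consists of $t$ distinct vertices $v_1,\dots,v_t$ and $t-1$ distinct hyperedges $h_1,\dots,h_{t-1}$ such that $\{v_i,v_{i+1}\}\subseteq h_i$ for all $1\le i\le t-1$. The Lagrangian of $\mathcal H$ is $$\lambda(\mathcal H)=\max\Big\{\sum_{e\in E}\prod_{i\in e}x_i \;:\; x\in\mathbb R_{\ge 0}^{V},\ \sum_{i\in V}|x_i|=1\Big\},$$ and $K^k_{m}$ denotes the complete $k$-uniform hypergraph on $m$ vertices. Then there is an integer $t_0=t_0(k)$ such that for all $t\ge t_0$ and all $n\ge t-1$ the following holds. Every $k$-uniform hypergraph $\mathcal H$ on $n$ vertices that contains no Berge-$P_t$ satisfies $$\lambda(\mathcal H)\le \lambda(K^k_{t-1})=\frac{1}{(t-1)^k}\binom{t-1}{k}.$$ The bound is tight: for all such $t$ and $n$ there is a $k$-uniform hypergraph on $n$ vertices that contains no Berge-$P_t$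 and whose Lagrangian equals $\lambda(K^k_{t-1})$. -/

import Mathlib

open scoped Hypergraph

namespace Hypergraph

/-- Every hyperedge has exactly `k` vertices. (Edges form a set of sets, so the hypergraph is
simple.) -/
def IsUniform {V : Type*} (H : Hypergraph V) (k : ℕ) : Prop :=
  ∀ e ∈ E(H), e.encard = k

/-- `H` contains a Berge-`P_t`: distinct vertices `v_0, …, v_{t-1}` and distinct hyperedges
`h_0, …, h_{t-2}` with `{v_i, v_{i+1}} ⊆ h_i` for each `i`. -/
def HasBergePath {V : Type*} (H : Hypergraph V) (t : ℕ) : Prop :=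
  ∃ (v : Fin t → V) (h : Fin (t - 1) → Set V),
    Function.Injective v ∧ Function.Injective h ∧
    (∀ i, v i ∈ V(H)) ∧ (∀ i, h i ∈ E(H)) ∧
    ∀ i : Fin (t - 1),
      {v ⟨i.1, by omega⟩, v ⟨i.1 + 1, by omega⟩} ⊆ h i

/-- The complete `k`-uniform hypergraph with vertex set the whole type `V`. -/
def completeUniform (V : Type*) (k : ℕ) : Hypergraph V where
  vertexSet := Set.univ
  edgeSet := {e | e.encard = k}
  subset_vertexSet_of_mem_edgeSet' := fun _ _ => Set.subset_univ _

open Classical in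
/-- The polynomial form `P_H(x) = ∑_{e ∈ E(H)} ∏_{i ∈ e} x_i`; the hyperedges are enumerated as
finite subsets of `V`. -/
noncomputable def polyForm {V : Type*} [Fintype V] (H : Hypergraph V) (x : V → ℝ) : ℝ :=
  ∑ e : Finset V with (e : Set V) ∈ E(H), ∏ i ∈ e, x i

/-- The Lagrangian of a hypergraph with vertex set the whole finite type `V`: the maximum of the
polynomial form over all nonnegative weights with `1`-norm equal to `1`. It is written as a supremum;
`isGreatest_lagrangian` shows that it is attained. -/
noncomputable def lagrangian {V : Type*} [Fintype V] (H : Hypergraph V) : ℝ :=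
  sSup (H.polyForm '' {x : V → ℝ | (∀ i, 0 ≤ x i) ∧ ∑ i, |x i| = 1})

theorem isGreatest_lagrangian {V : Type*} [Fintype V] [Nonempty V] (H : Hypergraph V) :
    IsGreatest (H.polyForm '' {x : V → ℝ | (∀ i, 0 ≤ x i) ∧ ∑ i, |x i| = 1}) H.lagrangian := by
  classical
  have hS : {x : V → ℝ | (∀ i, 0 ≤ x i) ∧ ∑ i, |x i| = 1} = stdSimplex ℝ V := by
    ext x
    refine and_congr_right fun hx => ?_
    simp only [abs_of_nonneg (hx _)]
  have hc : Continuous (H.polyForm) := by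
    unfold polyForm
    fun_prop
  unfold lagrangian
  rw [hS]
  refine ((isCompact_stdSimplex ℝ V).image hc).isGreatest_sSup (Set.Nonempty.image _ ?_)
  exact ⟨Pi.single (Classical.arbitrary V) 1, single_mem_stdSimplex ℝ _⟩

end Hypergraph

open Finset

/-! Put N = t - 1 and suppose that λ(H) > λ(K_N^k). Take an optimal weight x with support S as small
as possible. Then every pair in S lies in an edge (`IsOptimal.exists_mem_of_minimal`), and |S| > N,
since otherwise Maclaurin's inequality bounds the form by λ(K_N^k).

As k!λ(H) ≥ 1 - k²/N and all partial derivatives on S equal kλ(H), the link of each vertex of S is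
nearly complete in the weighted sense (`IsOptimal.sum_mul_one_sub_le`). Hence every weight is at
most k²/N. For k ≥ 3, a vertex is moreover joined to all but weight 1/4 of S by edges avoiding any
given t edges (`IsOptimal.sum_blocked_le`).

A Berge path in S on fewer than t vertices then grows (`IsBergeList.exists_extension`). Either its
first vertex has an unused edge leaving the path, or a vertex w off the path is joined to many path
vertices. In the latter case write the path as A B C and rebuild it as A w Bᵣ C; a double count
(`exists_good_pair`) finds cuts where the three new edges are unused and distinct. For k = 2 the set
S is a clique, so any ordering of it is a path. -/

/-- The form `∑_{e ∈ 𝓔} ∏_{i ∈ e} x_i` of a finite family of finite sets. -/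
noncomputable def familyForm {V : Type*} (𝓔 : Finset (Finset V)) (x : V → ℝ) : ℝ :=
  ∑ e ∈ 𝓔, ∏ i ∈ e, x i

/-! ### Algebra of the edge polynomial: links, Euler's identity, multi-affinity -/

section FamilyForm

variable {V : Type*} {𝓔 𝓕 : Finset (Finset V)} {x y : V → ℝ}

theorem familyForm_nonneg (hx : ∀ i, 0 ≤ x i) : 0 ≤ familyForm 𝓔 x :=
  sum_nonneg fun _ _ => prod_nonneg fun i _ => hx i

theorem familyForm_mono (hx : ∀ i, 0 ≤ x i) (h : 𝓔 ⊆ 𝓕) : familyForm 𝓔 x ≤ familyForm 𝓕 x :=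
  sum_le_sum_of_subset_of_nonneg h fun _ _ _ => prod_nonneg fun i _ => hx i

theorem familyForm_congr (h : ∀ e ∈ 𝓔, ∀ i ∈ e, x i = y i) : familyForm 𝓔 x = familyForm 𝓔 y :=
  sum_congr rfl fun e he => prod_congr rfl (h e he)

theorem familyForm_le_card_mul_pow {r : ℕ} {δ : ℝ} (hx : ∀ i, 0 ≤ x i) (hδ : ∀ i, x i ≤ δ)
    (hr : ∀ e ∈ 𝓔, #e = r) : familyForm 𝓔 x ≤ #𝓔 * δ ^ r := by
  rw [← nsmul_eq_mul]
  refine sum_le_card_nsmul _ _ _ fun e he => ?_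
  rw [← hr e he]
  exact (prod_le_prod (fun i _ => hx i) fun i _ => hδ i).trans_eq (prod_const δ)

variable [DecidableEq V]

theorem sum_filter_mem_prod (𝓔 : Finset (Finset V)) (x : V → ℝ) (a : V) :
    ∑ e ∈ 𝓔 with a ∈ e, ∏ i ∈ e, x i = x a * familyForm (𝓔.memberSubfamily a) x := by
  rw [familyForm, memberSubfamily, sum_image, mul_sum]
  · refine sum_congr rfl fun e he => ?_
    rw [mul_prod_erase _ _ (mem_filter.1 he).2]
  · intro e he f hf hef
    simp only [coe_filter, Set.mem_ofPred_eq] at he hf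
    rw [← insert_erase he.2, ← insert_erase hf.2]
    exact congrArg _ hef

theorem familyForm_eq_add (𝓔 : Finset (Finset V)) (x : V → ℝ) (a : V) :
    familyForm 𝓔 x =
      x a * familyForm (𝓔.memberSubfamily a) x + familyForm (𝓔.nonMemberSubfamily a) x := by
  rw [← sum_filter_mem_prod, familyForm, familyForm, nonMemberSubfamily,
    sum_filter_add_sum_filter_not]

theorem card_of_mem_memberSubfamily {k : ℕ} (h : ∀ e ∈ 𝓔, #e = k) (a : V) :
    ∀ e ∈ 𝓔.memberSubfamily a, #e = k - 1 := by
  intro e he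
  rw [mem_memberSubfamily] at he
  rw [← h _ he.1, card_insert_of_notMem he.2, Nat.add_sub_cancel]

/-- Euler's identity for the homogeneous form of a uniform family. -/
theorem sum_mul_familyForm_memberSubfamily [Fintype V] {k : ℕ} (h : ∀ e ∈ 𝓔, #e = k)
    (x : V → ℝ) : ∑ u, x u * familyForm (𝓔.memberSubfamily u) x = k * familyForm 𝓔 x := by
  simp_rw [← sum_filter_mem_prod, sum_filter]
  rw [sum_comm, familyForm, mul_sum]
  refine sum_congr rfl fun e he => ?_
  rw [sum_ite_mem, univ_inter, sum_const, nsmul_eq_mul, h e he]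

/-- The form depends on two chosen coordinates in a multi-affine way. -/
theorem exists_multiaffine (𝓔 : Finset (Finset V)) (x : V → ℝ) {i j : V} (hij : i ≠ j) :
    ∃ α β γ : ℝ,
      (∀ y : V → ℝ, (∀ l, l ≠ i → l ≠ j → y l = x l) →
        familyForm 𝓔 y = α + y i * β + y j * γ +
          y i * y j * familyForm ((𝓔.memberSubfamily i).memberSubfamily j) x) ∧
      familyForm (𝓔.memberSubfamily i) x =
        β + x j * familyForm ((𝓔.memberSubfamily i).memberSubfamily j) x ∧
      familyForm (𝓔.memberSubfamily j) x =
        γ + x i * familyForm ((𝓔.memberSubfamily i).memberSubfamily j) x := by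
  have hc : (𝓔.memberSubfamily j).memberSubfamily i = (𝓔.memberSubfamily i).memberSubfamily j := by
    ext s
    simp only [mem_memberSubfamily, mem_insert, Finset.insert_comm i j, not_or]
    tauto
  have hc' : (𝓔.nonMemberSubfamily i).memberSubfamily j =
      (𝓔.memberSubfamily j).nonMemberSubfamily i := by
    ext s
    simp only [mem_memberSubfamily, mem_nonMemberSubfamily, mem_insert, not_or]
    tauto
  refine ⟨familyForm ((𝓔.nonMemberSubfamily i).nonMemberSubfamily j) x,
    familyForm ((𝓔.memberSubfamily i).nonMemberSubfamily j) x,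
    familyForm ((𝓔.nonMemberSubfamily i).memberSubfamily j) x, fun y hy => ?_, ?_, ?_⟩
  · rw [familyForm_eq_add 𝓔 y i, familyForm_eq_add (𝓔.memberSubfamily i) y j,
      familyForm_eq_add (𝓔.nonMemberSubfamily i) y j]
    have h : ∀ 𝓖 : Finset (Finset V), (∀ e ∈ 𝓖, i ∉ e ∧ j ∉ e) →
        familyForm 𝓖 y = familyForm 𝓖 x := fun 𝓖 h𝓖 => familyForm_congr fun e he l hl =>
      hy l (fun h => (h𝓖 e he).1 (h ▸ hl)) fun h => (h𝓖 e he).2 (h ▸ hl)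
    rw [h, h, h, h]
    · ring
    all_goals
      intro e he
      simp only [mem_memberSubfamily, mem_nonMemberSubfamily, mem_insert, not_or] at he
      tauto
  · rw [familyForm_eq_add (𝓔.memberSubfamily i) x j]; ring
  · rw [familyForm_eq_add (𝓔.memberSubfamily j) x i, hc, hc']; ring

/-- `r!` times the elementary symmetric polynomial of degree `r` is at most `1` on the simplex. -/
theorem factorial_mul_familyForm_le_one [Fintype V] (hx : ∀ i, 0 ≤ x i) (h1 : ∑ i, x i = 1) :
    ∀ (r : ℕ) (𝓔 : Finset (Finset V)), (∀ e ∈ 𝓔, #e = r) →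
      (r.factorial : ℝ) * familyForm 𝓔 x ≤ 1 := by
  intro r
  induction r with
  | zero =>
    intro 𝓔 h
    have : 𝓔 ⊆ {∅} := fun e he => by simpa using h e he
    refine (mul_le_mul_of_nonneg_left (familyForm_mono hx this) (by positivity)).trans ?_
    simp [familyForm]
  | succ r ih =>
    intro 𝓔 h
    have he := sum_mul_familyForm_memberSubfamily h x
    -- Euler's identity turns the factor r + 1 into a sum over links, and the induction hypothesis
    -- bounds the term of u by `x u`.
    rw [Nat.factorial_succ, Nat.mul_comm, Nat.cast_mul, mul_assoc, ← he, mul_sum, ← h1]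
    refine sum_le_sum fun u _ => ?_
    have := ih _ (card_of_mem_memberSubfamily h u)
    calc (r.factorial : ℝ) * (x u * familyForm (𝓔.memberSubfamily u) x)
        = x u * (r.factorial * familyForm (𝓔.memberSubfamily u) x) := by ring
      _ ≤ x u := mul_le_of_le_one_right (hx u) this

end FamilyForm

/-! ### Optimal weights: first-order conditions and minimal support -/

section Optimum

variable {V : Type*} [Fintype V] [DecidableEq V] {𝓔 : Finset (Finset V)} {x : V → ℝ}

/-- `x` maximises the form of `𝓔` on the standard simplex. -/
structure IsOptimal (𝓔 : Finset (Finset V)) (x : V → ℝ) : Prop where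
  nonneg : ∀ i, 0 ≤ x i
  sum_eq : ∑ i, x i = 1
  le : ∀ y : V → ℝ, (∀ i, 0 ≤ y i) → ∑ i, y i = 1 → familyForm 𝓔 y ≤ familyForm 𝓔 x

/-- The effect of moving the mass `s` from `j` to `i`. -/
theorem exists_shift (hx : ∀ i, 0 ≤ x i) (h1 : ∑ i, x i = 1) {i j : V} (hij : i ≠ j) {s : ℝ}
    (hs : -x i ≤ s) (hs' : s ≤ x j) :
    ∃ y : V → ℝ, (∀ l, 0 ≤ y l) ∧ ∑ l, y l = 1 ∧ y i = x i + s ∧ y j = x j - s ∧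
      (∀ l, l ≠ i → l ≠ j → y l = x l) ∧
      ∀ 𝓔 : Finset (Finset V), familyForm 𝓔 y = familyForm 𝓔 x +
        s * (familyForm (𝓔.memberSubfamily i) x - familyForm (𝓔.memberSubfamily j) x) -
        s ^ 2 * familyForm ((𝓔.memberSubfamily i).memberSubfamily j) x := by
  refine ⟨fun l => x l + (if l = i then s else 0) - (if l = j then s else 0), fun l => ?_, ?_,
    ?_, ?_, ?_, fun 𝓔 => ?_⟩
  · have := hx l
    beta_reduce
    split_ifs with h h' h'
    · exact absurd (h.symm.trans h') hij
    · subst h; linarith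
    · subst h'; linarith
    · linarith
  · simp [sum_sub_distrib, sum_add_distrib, h1]
  · simp [hij]
  · simp [hij.symm]
  · intro l hi hj; simp [hi, hj]
  · obtain ⟨α, β, γ, h, hi, hj⟩ := exists_multiaffine 𝓔 x hij
    rw [h x fun _ _ _ => rfl, h _ fun l hi hj => by simp [hi, hj], hi, hj]
    simp only [hij, hij.symm, if_true, if_false]
    ring

theorem IsOptimal.shift_le (hx : IsOptimal 𝓔 x) {i j : V} (hij : i ≠ j) {s : ℝ}
    (hs : -x i ≤ s) (hs' : s ≤ x j) :
    s * (familyForm (𝓔.memberSubfamily i) x - familyForm (𝓔.memberSubfamily j) x) ≤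
        s ^ 2 * familyForm ((𝓔.memberSubfamily i).memberSubfamily j) x := by
  obtain ⟨y, hy, hy1, -, -, -, h⟩ := exists_shift hx.nonneg hx.sum_eq hij hs hs'
  have := hx.le y hy hy1
  rw [h] at this
  linarith

theorem IsOptimal.deriv_le (hx : IsOptimal 𝓔 x) {i j : V} (hj : 0 < x j) :
    familyForm (𝓔.memberSubfamily i) x ≤ familyForm (𝓔.memberSubfamily j) x := by
  rcases eq_or_ne i j with rfl | hij
  · rfl
  set κ := familyForm ((𝓔.memberSubfamily i).memberSubfamily j) x
  have hκ : 0 ≤ κ := familyForm_nonneg hx.nonneg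
  by_contra! hlt
  set d := familyForm (𝓔.memberSubfamily i) x - familyForm (𝓔.memberSubfamily j) x with hd
  have hd0 : 0 < d := sub_pos.2 hlt
  -- So small that the linear gain s·d exceeds the quadratic loss s²·κ.
  set s := min (x j) (d / (2 * (κ + 1))) with hs
  have hs0 : 0 < s := lt_min hj (by positivity)
  have h := hx.shift_le hij (s := s) (by linarith [hx.nonneg i]) (min_le_left _ _)
  have hsd : s * (2 * (κ + 1)) ≤ d := (le_div_iff₀ (by positivity)).1 (min_le_right _ _)
  rw [pow_two, mul_assoc] at h
  have h' : d ≤ s * κ := le_of_mul_le_mul_left h hs0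
  nlinarith

/-- The derivatives agree on the support, and by Euler's identity their x-weighted mean is k times
the form. -/
theorem IsOptimal.deriv_eq (hx : IsOptimal 𝓔 x) {k : ℕ} (hk : ∀ e ∈ 𝓔, #e = k) {i : V}
    (hi : 0 < x i) : familyForm (𝓔.memberSubfamily i) x = k * familyForm 𝓔 x := by
  rw [← sum_mul_familyForm_memberSubfamily hk, ← one_mul (familyForm _ _), ← hx.sum_eq, sum_mul]
  refine sum_congr rfl fun u _ => ?_
  rcases (hx.nonneg u).eq_or_lt with hu | hu
  · rw [← hu, zero_mul, zero_mul]
  · rw [(hx.deriv_le (j := u) hu).antisymm (hx.deriv_le hi)]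

theorem exists_isOptimal [Nonempty V] (𝓔 : Finset (Finset V)) :
    ∃ x, IsOptimal 𝓔 x ∧ ∀ y, IsOptimal 𝓔 y → #{i | 0 < x i} ≤ #{i | 0 < y i} := by
  have hc : Continuous (familyForm 𝓔) := by unfold familyForm; fun_prop
  obtain ⟨x, hx, hmax⟩ := (isCompact_stdSimplex ℝ V).exists_isMaxOn
    ⟨_, single_mem_stdSimplex ℝ (Classical.arbitrary V)⟩ hc.continuousOn
  have hne : {x : V → ℝ | IsOptimal 𝓔 x}.Nonempty := ⟨x, hx.1, hx.2, fun y h0 h1 => hmax ⟨h0, h1⟩⟩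
  obtain ⟨z, hz, hmin⟩ := WellFounded.has_min
    (InvImage.wf (fun x : V → ℝ => #{i | 0 < x i}) wellFounded_lt) _ hne
  exact ⟨z, hz, fun y hy => not_lt.1 (hmin y hy)⟩

/-- In an optimum of minimal support every pair of the support is covered (Frankl–Rödl). -/
theorem IsOptimal.exists_mem_of_minimal (hx : IsOptimal 𝓔 x)
    (hmin : ∀ y, IsOptimal 𝓔 y → #{i | 0 < x i} ≤ #{i | 0 < y i}) {i j : V} (hij : i ≠ j)
    (hi : 0 < x i) (hj : 0 < x j) : ∃ e ∈ 𝓔, i ∈ e ∧ j ∈ e := by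
  by_contra! hno
  have hem : (𝓔.memberSubfamily i).memberSubfamily j = ∅ := by
    refine eq_empty_of_forall_notMem fun s hs => ?_
    simp only [mem_memberSubfamily] at hs
    exact hno _ hs.1.1 (by simp) (by simp)
  -- Without a common edge the quadratic term vanishes, and the linear term vanishes by equality of
  -- derivatives. Moving all mass from j to i thus keeps the optimum and shrinks the support.
  obtain ⟨y, hy0, hy1, hyi, hyj, hyo, h⟩ := exists_shift hx.nonneg hx.sum_eq hij (s := x j)
    (by linarith) le_rfl
  have heq : familyForm 𝓔 y = familyForm 𝓔 x := by
    rw [h, hem, (hx.deriv_le (i := i) hj).antisymm (hx.deriv_le hi)]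
    simp [familyForm]
  refine absurd (hmin y ⟨hy0, hy1, fun z h0 h1 => (hx.le z h0 h1).trans_eq heq.symm⟩)
    (not_le.2 (card_lt_card ?_))
  refine (ssubset_iff_of_subset fun l hl => ?_).2 ⟨j, by simpa using hj, by simp [hyj]⟩
  simp only [mem_filter, mem_univ, true_and] at hl ⊢
  rcases eq_or_ne l i with rfl | h1
  · exact hi
  rcases eq_or_ne l j with rfl | h2
  · exact hj
  · rwa [hyo l h1 h2] at hl

end Optimum

/-! ### Maclaurin's inequality -/

section Maclaurin

variable {V : Type*}

theorem familyForm_powersetCard_const (T : Finset V) (k : ℕ) (c : ℝ) :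
    familyForm (powersetCard k T) (fun _ => c) = (#T).choose k * c ^ k := by
  rw [familyForm, sum_congr rfl (g := fun _ => c ^ k), sum_const, card_powersetCard, nsmul_eq_mul]
  intro e he
  rw [prod_const, (mem_powersetCard.1 he).2]

/-- Maclaurin's inequality between the elementary symmetric polynomials of degree `k` and `1`. -/
theorem familyForm_powersetCard_univ_le [Fintype V] {k : ℕ} (hk : 2 ≤ k) (hkV : k ≤ Fintype.card V)
    {y : V → ℝ} (hy : ∀ i, 0 ≤ y i) (hy1 : ∑ i, y i = 1) :
    familyForm (powersetCard k univ) y ≤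
      (Fintype.card V).choose k / (Fintype.card V : ℝ) ^ k := by
  classical
  have hV : 0 < Fintype.card V := by omega
  have : Nonempty V := Fintype.card_pos_iff.1 hV
  set m : ℝ := ((Fintype.card V : ℕ) : ℝ)
  have hm : 0 < m := Nat.cast_pos.2 hV
  set 𝓔 : Finset (Finset V) := powersetCard k univ with h𝓔
  obtain ⟨x, hx, -⟩ := exists_isOptimal 𝓔
  have hunif : familyForm 𝓔 (fun _ => m⁻¹) = (Fintype.card V).choose k / m ^ k := by
    rw [familyForm_powersetCard_const, card_univ, inv_pow, div_eq_mul_inv]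
  have hsum : ∑ _i : V, m⁻¹ = 1 := by
    rw [sum_const, card_univ, nsmul_eq_mul, mul_inv_cancel₀ hm.ne']
  have hpos : 0 < familyForm 𝓔 x := by
    refine lt_of_lt_of_le ?_ (hx.le (fun _ => m⁻¹) (fun _ => by positivity) hsum)
    rw [hunif]
    have := Nat.choose_pos hkV
    positivity
  obtain ⟨e, he, hpe⟩ := exists_ne_zero_of_sum_ne_zero hpos.ne'
  have hconst : ∀ i j, x i = x j := by
    intro i j
    by_contra hne
    have hij : i ≠ j := fun h => hne (h ▸ rfl)
    -- Some edge e has positive product; k - 2 of its vertices other than i and j give a positive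
    -- term.
    have hκ : 0 < familyForm ((𝓔.memberSubfamily i).memberSubfamily j) x := by
      have hcard : k - 2 ≤ #((e.erase i).erase j) := by
        have h1 := pred_card_le_card_erase (s := e) (a := i)
        have h2 := pred_card_le_card_erase (s := e.erase i) (a := j)
        have h3 := (mem_powersetCard.1 he).2
        omega
      obtain ⟨f, hf, hfc⟩ := exists_subset_card_eq hcard
      have hif : i ∉ f := fun h => by simpa using hf h
      have hjf : j ∉ f := fun h => by simpa using hf h
      refine lt_of_lt_of_le (b := ∏ l ∈ f, x l) ?_ ?_
      · refine prod_pos fun l hl => (hx.nonneg l).lt_of_ne' ?_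
        exact prod_ne_zero_iff.1 hpe l (mem_of_mem_erase (mem_of_mem_erase (hf hl)))
      · refine single_le_sum (f := fun f => ∏ l ∈ f, x l)
          (fun _ _ => prod_nonneg fun l _ => hx.nonneg l) ?_
        simp only [mem_memberSubfamily, h𝓔, mem_powersetCard, subset_univ, true_and, mem_insert,
          not_or]
        refine ⟨⟨?_, hij, hif⟩, hjf⟩
        rw [card_insert_of_notMem (by simp [hij, hif]), card_insert_of_notMem hjf]
        omega
    obtain ⟨y, -, -, hyi, hyj, hyo, h⟩ := exists_shift hx.nonneg hx.sum_eq hij (s := x j - x i)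
      (by linarith [hx.nonneg j]) (by linarith [hx.nonneg i])
    have hswap : y = x ∘ Equiv.swap i j := by
      funext l
      rcases eq_or_ne l i with rfl | hi
      · simp [hyi]
      rcases eq_or_ne l j with rfl | hj
      · simp [hyj]
      · simp [Equiv.swap_apply_of_ne_of_ne hi hj, hyo l hi hj]
    have hsym : familyForm 𝓔 y = familyForm 𝓔 x := by
      have hmap : 𝓔 = 𝓔.map (mapEmbedding (Equiv.swap i j).toEmbedding).toEmbedding := by
        rw [h𝓔, ← powersetCard_map, map_univ_equiv]
      conv_rhs => rw [hmap]
      rw [familyForm, familyForm, sum_map]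
      refine sum_congr rfl fun e _ => ?_
      rw [hswap]
      simp [mapEmbedding]
    -- With s = x j - x i and d the difference of derivatives, the swap preserves the form, so s·d =
    -- s²κ. Averaging the two coordinates changes the form by s·d/2 - s²κ/4 = s²κ/4 > 0,
    -- contradicting optimality.
    have hhalf := hx.shift_le hij (s := (x j - x i) / 2)
      (by linarith [hx.nonneg j, hx.nonneg i]) (by linarith [hx.nonneg i, hx.nonneg j])
    have h' := h 𝓔
    rw [hsym] at h'
    have hsq : 0 < (x j - x i) ^ 2 := by
      have : x j - x i ≠ 0 := sub_ne_zero.2 (Ne.symm hne)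
      positivity
    nlinarith [mul_pos hsq hκ]
  have hxm : x = fun _ => m⁻¹ := by
    funext i
    have h1 := hx.sum_eq
    rw [sum_congr rfl fun j _ => hconst j i, sum_const, card_univ, nsmul_eq_mul] at h1
    exact eq_inv_of_mul_eq_one_right h1
  rw [← hunif, ← hxm]
  exact hx.le y hy hy1

/-- Maclaurin's inequality on a subset carrying the whole mass. -/
theorem familyForm_powersetCard_le {k : ℕ} (hk : 2 ≤ k) {T : Finset V} (hkT : k ≤ #T)
    {y : V → ℝ} (hy : ∀ i, 0 ≤ y i) (hy1 : ∑ i ∈ T, y i = 1) :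
    familyForm (powersetCard k T) y ≤ (#T).choose k / (#T : ℝ) ^ k := by
  have h := familyForm_powersetCard_univ_le (V := T) hk (by simpa using hkT) (y := fun i => y i)
    (fun i => hy i) (by rw [← hy1, sum_coe_sort])
  rw [Fintype.card_coe] at h
  refine le_trans (le_of_eq ?_) h
  have hmap : powersetCard k T =
      (powersetCard k univ).map (mapEmbedding (Function.Embedding.subtype (· ∈ T))).toEmbedding := by
    rw [← powersetCard_map]
    congr 1
    ext a
    simp
  rw [hmap, familyForm, familyForm, sum_map]
  refine sum_congr rfl fun e _ => ?_
  simp [mapEmbedding]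

end Maclaurin

/-! ### Berge paths as lists, and their extension -/

/-- `f` assigns to the pairs in `T` distinct members of `𝓔` that contain them. -/
structure IsPairMatching {V : Type*} (𝓔 : Finset (Finset V)) (f : Sym2 V → Finset V)
    (T : Finset (Sym2 V)) : Prop where
  injOn : Set.InjOn f T
  mem : ∀ p ∈ T, f p ∈ 𝓔
  sub : ∀ p ∈ T, ∀ v ∈ p, v ∈ f p

/-- The list `L` is the vertex sequence of a Berge path with hyperedges in `𝓔`. -/
def IsBergeList {V : Type*} (𝓔 : Finset (Finset V)) (L : List V) : Prop :=
  L.Nodup ∧ ∃ f T, IsPairMatching 𝓔 f T ∧ L.IsChain fun a b => s(a, b) ∈ T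

/-- Splitting a list after the positions `i < j`. -/
theorem exists_split {V : Type*} {L : List V} {z : V} {i j : ℕ} (hij : i < j) (hj : j + 1 < L.length) :
    ∃ A B C : List V, L = A ++ B ++ C ∧ A.getLast? = some (L.getD i z) ∧
      B.head? = some (L.getD (i + 1) z) ∧ B.getLast? = some (L.getD j z) ∧
      C.head? = some (L.getD (j + 1) z) := by
  refine ⟨L.take (i + 1), (L.drop (i + 1)).take (j - i), L.drop (j + 1), ?_, ?_, ?_, ?_, ?_⟩
  · rw [← List.take_add, show i + 1 + (j - i) = j + 1 by omega, List.take_append_drop]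
  · rw [List.getLast?_eq_getElem?, List.getD_eq_getElem _ _ (by omega)]
    simp
    grind
  · rw [List.head?_eq_getElem?, List.getD_eq_getElem _ _ (by omega)]
    simp [List.getElem?_take, List.getElem?_drop]
    grind
  · rw [List.getLast?_eq_getElem?, List.getD_eq_getElem _ _ (by omega)]
    simp [List.getElem?_take, List.getElem?_drop]
    grind
  · rw [List.head?_eq_getElem?, List.getD_eq_getElem _ _ (by omega)]
    simp [List.getElem?_drop]

theorem sum_union_le_add {V : Type*} [DecidableEq V] {x : V → ℝ} (hx : ∀ i, 0 ≤ x i)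
    (s t : Finset V) : ∑ i ∈ s ∪ t, x i ≤ ∑ i ∈ s, x i + ∑ i ∈ t, x i := by
  rw [← sum_union_inter]
  exact le_add_of_nonneg_right (sum_nonneg fun i _ => hx i)

section BergeList

variable {V : Type*} [DecidableEq V] {𝓔 : Finset (Finset V)} {f : Sym2 V → Finset V}
  {T : Finset (Sym2 V)} {L : List V}

/-- If the pair already has an edge, that edge is overwritten. The bound on the image shows that
other unused edges remain available for further insertions. -/
theorem IsPairMatching.exists_insert (h : IsPairMatching 𝓔 f T) {a b : V} {e : Finset V} (he : e ∈ 𝓔)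
    (heT : e ∉ T.image f) (ha : a ∈ e) (hb : b ∈ e) :
    ∃ f', IsPairMatching 𝓔 f' (insert s(a, b) T) ∧
      (insert s(a, b) T).image f' ⊆ insert e (T.image f) := by
  have hne : ∀ p ∈ T, f p ≠ e := fun p hp hpe => heT (mem_image.2 ⟨p, hp, hpe⟩)
  refine ⟨Function.update f s(a, b) e, ⟨?_, ?_, ?_⟩, ?_⟩
  · intro p hp q hq hpq
    simp only [coe_insert, Set.mem_insert_iff, mem_coe] at hp hq
    by_cases h1 : p = s(a, b) <;> by_cases h2 : q = s(a, b)
    · rw [h1, h2]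
    · rw [h1, Function.update_self, Function.update_of_ne h2] at hpq
      exact absurd hpq.symm (hne q (hq.resolve_left h2))
    · rw [h2, Function.update_self, Function.update_of_ne h1] at hpq
      exact absurd hpq (hne p (hp.resolve_left h1))
    · rw [Function.update_of_ne h1, Function.update_of_ne h2] at hpq
      exact h.injOn (hp.resolve_left h1) (hq.resolve_left h2) hpq
  · intro p hp
    by_cases h1 : p = s(a, b)
    · rwa [h1, Function.update_self]
    · rw [Function.update_of_ne h1]
      exact h.mem p ((mem_insert.1 hp).resolve_left h1)
  · intro p hp v hv
    by_cases h1 : p = s(a, b)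
    · rw [h1, Function.update_self]
      rw [h1, Sym2.mem_iff] at hv
      rcases hv with rfl | rfl <;> assumption
    · rw [Function.update_of_ne h1]
      exact h.sub p ((mem_insert.1 hp).resolve_left h1) v hv
  · intro g hg
    obtain ⟨p, hp, rfl⟩ := mem_image.1 hg
    by_cases h1 : p = s(a, b)
    · rw [h1, Function.update_self]; exact mem_insert_self _ _
    · rw [Function.update_of_ne h1]
      exact mem_insert_of_mem (mem_image_of_mem _ ((mem_insert.1 hp).resolve_left h1))

/-- The matching of a Berge path may be taken to use only as many pairs as the path. -/
theorem IsBergeList.exists_card_le (h : IsBergeList 𝓔 L) :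
    ∃ f T, IsPairMatching 𝓔 f T ∧ (L.IsChain fun a b => s(a, b) ∈ T) ∧ #T ≤ L.length := by
  obtain ⟨-, f, T, hf, hc⟩ := h
  rcases L with _ | ⟨z, L₀⟩
  · exact ⟨f, ∅, ⟨by simp, by simp, by simp⟩, by simp, by simp⟩
  set L := z :: L₀
  -- The last index pairs the final vertex with the default `z`; this possible extra pair is
  -- harmless to the bound by `L.length`.
  set T' := T.filter (· ∈ (range L.length).image fun i => s(L.getD i z, L.getD (i + 1) z))
  have hT' : T' ⊆ T := filter_subset _ _
  refine ⟨f, T', ⟨hf.injOn.mono (by exact_mod_cast hT'), fun p hp => hf.mem p (hT' hp),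
    fun p hp => hf.sub p (hT' hp)⟩, ?_, ?_⟩
  · rw [List.isChain_iff_getElem] at hc ⊢
    intro i hi
    refine mem_filter.2 ⟨hc i hi, mem_image.2 ⟨i, by simp; omega, ?_⟩⟩
    rw [List.getD_eq_getElem _ _ (by omega), List.getD_eq_getElem _ _ hi]
  · refine (card_le_card (t := (range L.length).image fun i => s(L.getD i z, L.getD (i + 1) z))
      fun p hp => (mem_filter.1 hp).2).trans (card_image_le.trans (card_range _).le)

theorem IsPairMatching.isBergeList_cons (h : IsPairMatching 𝓔 f T)
    (hc : L.IsChain fun a b => s(a, b) ∈ T) (hn : L.Nodup) {u z : V} (hz : L.head? = some z)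
    (hu : u ∉ L) {e : Finset V} (he : e ∈ 𝓔) (heT : e ∉ T.image f) (hze : z ∈ e) (hue : u ∈ e) :
    IsBergeList 𝓔 (u :: L) := by
  obtain ⟨f', hf', -⟩ := h.exists_insert he heT hue hze
  refine ⟨List.nodup_cons.2 ⟨hu, hn⟩, f', _, hf', List.isChain_cons.2 ⟨?_, ?_⟩⟩
  · intro y hy
    rw [hz, Option.mem_some_iff] at hy
    rw [← hy]
    exact mem_insert_self _ _
  · exact hc.imp fun _ _ h => mem_insert_of_mem h

/-- Inserting `w` into a path `A B C`, turned into `A w Bᵣ C`. -/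
theorem IsPairMatching.isBergeList_splice (h : IsPairMatching 𝓔 f T) {A B C : List V}
    (hc : (A ++ B ++ C).IsChain fun a b => s(a, b) ∈ T) (hn : (A ++ B ++ C).Nodup)
    {w a b c d : V} (hw : w ∉ A ++ B ++ C) (ha : A.getLast? = some a) (hb : B.head? = some b)
    (hc' : B.getLast? = some c) (hd : C.head? = some d) {e₁ e₂ e₃ : Finset V}
    (he₁ : e₁ ∈ 𝓔) (he₂ : e₂ ∈ 𝓔) (he₃ : e₃ ∈ 𝓔) (h₁ : e₁ ∉ T.image f) (h₂ : e₂ ∉ T.image f)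
    (h₃ : e₃ ∉ T.image f) (h12 : e₁ ≠ e₂) (h13 : e₁ ≠ e₃) (h23 : e₂ ≠ e₃) (ha₁ : a ∈ e₁)
    (hw₁ : w ∈ e₁) (hw₂ : w ∈ e₂) (hc₂ : c ∈ e₂) (hb₃ : b ∈ e₃) (hd₃ : d ∈ e₃) :
    IsBergeList 𝓔 (A ++ w :: (B.reverse ++ C)) := by
  obtain ⟨f₁, hf₁, hi₁⟩ := h.exists_insert he₁ h₁ ha₁ hw₁
  obtain ⟨f₂, hf₂, hi₂⟩ := hf₁.exists_insert he₂
    (fun h => by simpa [h12.symm, h₂] using hi₁ h) hw₂ hc₂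
  obtain ⟨f₃, hf₃, -⟩ := hf₂.exists_insert he₃
    (fun h => by
      rcases mem_insert.1 (hi₂ h) with h' | h'
      · exact h23 h'.symm
      · simpa [h13.symm, h₃] using hi₁ h') hb₃ hd₃
  refine ⟨?_, f₃, _, hf₃, ?_⟩
  · have hp : (A ++ w :: (B.reverse ++ C)).Perm (w :: (A ++ B ++ C)) := by
      refine List.perm_middle.trans (List.Perm.cons w ?_)
      rw [List.append_assoc]
      exact ((List.reverse_perm B).append_right C).append_left A
    exact hp.nodup_iff.2 (List.nodup_cons.2 ⟨hw, hn⟩)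
  · set T' := insert s(b, d) (insert s(w, c) (insert s(a, w) T)) with hT'
    have hTT' : T ⊆ T' := fun p hp => by simp [hT', hp]
    have hc0 := hc.imp (S := fun a b => s(a, b) ∈ T') fun _ _ h => hTT' h
    rw [List.isChain_append, List.isChain_append] at hc0
    obtain ⟨⟨hA, hB, -⟩, hC, -⟩ := hc0
    rw [List.isChain_append]
    refine ⟨hA, List.isChain_cons.2 ⟨?_, List.isChain_append.2 ⟨?_, hC, ?_⟩⟩, ?_⟩
    · intro y hy
      rw [List.head?_append, List.head?_reverse, hc', Option.some_or, Option.mem_some_iff] at hy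
      subst hy
      simp [hT']
    -- Edges are attached to unordered pairs, so a reversed segment keeps its edges.
    · rw [List.isChain_reverse]
      exact hB.imp fun _ _ h => by rwa [Sym2.eq_swap]
    · intro p hp q hq
      rw [List.getLast?_reverse, hb, Option.mem_some_iff] at hp
      rw [hd, Option.mem_some_iff] at hq
      subst hp hq
      simp [hT']
    · intro p hp q hq
      rw [ha, Option.mem_some_iff] at hp
      rw [List.head?_cons, Option.mem_some_iff] at hq
      subst hp hq
      simp [hT']

/-- The double count behind the choice of the two places where a path is cut open. `v` enumerates
the path, `g i` joins the new vertex to `v i`, and `U` is the set of hyperedges in use. -/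
theorem exists_good_pair {k t m : ℕ} {U : Finset (Finset V)} (hk : ∀ e ∈ 𝓔, #e = k) (hU : U ⊆ 𝓔)
    (hUt : #U ≤ t) {I : Finset ℕ} (hI : ∀ i ∈ I, i + 1 < m) {v : ℕ → V}
    (hv : Set.InjOn v (Set.Iio m)) {g : ℕ → Finset V} (hg : ∀ i ∈ I, g i ∈ 𝓔)
    (hcard : 3 * k * #I + t * k ^ 2 < #I ^ 2) :
    ∃ i ∈ I, ∃ j ∈ I, v j ∉ g i ∧ v (j + 1) ∉ g i ∧ v (i + 1) ∉ g j ∧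
      ∀ e ∈ U, v (i + 1) ∈ e → v (j + 1) ∉ e := by
  by_contra! hno
  have hcount : ∀ e ∈ 𝓔, #{j ∈ I | v j ∈ e} ≤ k := fun e he => by
    rw [← hk e he]
    refine card_le_card_of_injOn v (fun j hj => (mem_filter.1 hj).2) fun a ha b hb hab => ?_
    have h1 := hI a (mem_filter.1 ha).1
    have h2 := hI b (mem_filter.1 hb).1
    exact hv (by simp; omega) (by simp; omega) hab
  have hcount' : ∀ e ∈ 𝓔, #{j ∈ I | v (j + 1) ∈ e} ≤ k := fun e he => by
    rw [← hk e he]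
    refine card_le_card_of_injOn (fun j => v (j + 1)) (fun j hj => (mem_filter.1 hj).2)
      fun a ha b hb hab => ?_
    have h1 := hI a (mem_filter.1 ha).1
    have h2 := hI b (mem_filter.1 hb).1
    have := hv (by simp; omega) (by simp; omega) hab
    omega
  -- An edge meets the path in at most k vertices. Each of the first three failures therefore
  -- accounts for at most k·#I pairs, and the last for at most k² pairs per edge of U.
  have hsub : I ×ˢ I ⊆ (I.sigma fun i => {j ∈ I | v j ∈ g i}).image (fun p => (p.1, p.2)) ∪
      (I.sigma fun i => {j ∈ I | v (j + 1) ∈ g i}).image (fun p => (p.1, p.2)) ∪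
      (I.sigma fun j => {i ∈ I | v (i + 1) ∈ g j}).image (fun p => (p.2, p.1)) ∪
      U.biUnion fun e => {j ∈ I | v (j + 1) ∈ e} ×ˢ {j ∈ I | v (j + 1) ∈ e} := by
    rintro ⟨i, j⟩ hij
    obtain ⟨hi, hj⟩ := mem_product.1 hij
    simp only [mem_union, mem_image, mem_sigma, mem_filter, mem_biUnion, mem_product, Sigma.exists,
      Prod.mk.injEq]
    by_contra! hcon
    obtain ⟨⟨⟨h1, h2⟩, h3⟩, h4⟩ := hcon
    obtain ⟨e, heU, h5, h6⟩ := hno i hi j hj (fun h => (h1 i j ⟨hi, hj, h⟩ rfl) rfl)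
      (fun h => (h2 i j ⟨hi, hj, h⟩ rfl) rfl) (fun h => (h3 j i ⟨hj, hi, h⟩ rfl) rfl)
    exact h4 e heU ⟨hi, h5⟩ hj h6
  have hsig : ∀ q : ℕ → Finset ℕ, (∀ i ∈ I, #(q i) ≤ k) → #(I.sigma q) ≤ #I * k := fun q hq => by
    rw [card_sigma, ← smul_eq_mul]
    exact sum_le_card_nsmul _ _ _ hq
  have h1 := (card_image_le (f := fun p : (_ : ℕ) × ℕ => (p.1, p.2))).trans
    (hsig (fun i => {j ∈ I | v j ∈ g i}) fun i hi => hcount _ (hg i hi))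
  have h2 := (card_image_le (f := fun p : (_ : ℕ) × ℕ => (p.1, p.2))).trans
    (hsig (fun i => {j ∈ I | v (j + 1) ∈ g i}) fun i hi => hcount' _ (hg i hi))
  have h3 := (card_image_le (f := fun p : (_ : ℕ) × ℕ => (p.2, p.1))).trans
    (hsig (fun j => {i ∈ I | v (i + 1) ∈ g j}) fun i hi => hcount' _ (hg i hi))
  have h4 : #(U.biUnion fun e => {j ∈ I | v (j + 1) ∈ e} ×ˢ {j ∈ I | v (j + 1) ∈ e}) ≤
      t * k ^ 2 := by
    refine card_biUnion_le.trans ((sum_le_card_nsmul _ _ (k ^ 2) fun e he => ?_).trans ?_)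
    · rw [card_product, pow_two]
      exact Nat.mul_le_mul (hcount' e (hU he)) (hcount' e (hU he))
    · rw [smul_eq_mul]
      exact Nat.mul_le_mul_right _ hUt
  have h5 := (card_le_card hsub).trans ((card_union_le _ _).trans (Nat.add_le_add_right
    ((card_union_le _ _).trans (Nat.add_le_add_right (card_union_le _ _) _)) _))
  rw [card_product, ← pow_two] at h5
  nlinarith

/-- The vertices that are not joined to `i` by a hyperedge outside `U`. -/
def blocked (𝓔 U : Finset (Finset V)) (S : Finset V) (i : V) : Finset V :=
  {u ∈ S | u = i ∨ ∀ e ∈ 𝓔, i ∈ e → u ∈ e → e ∈ U}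

/-- A Berge path on fewer than `t` vertices can be extended when few vertices are blocked. -/
theorem IsBergeList.exists_extension {k t : ℕ} (hk : ∀ e ∈ 𝓔, #e = k) {S : Finset V} {x : V → ℝ}
    {δ : ℝ} (hcov : ∀ i ∈ S, ∀ j ∈ S, i ≠ j → ∃ e ∈ 𝓔, i ∈ e ∧ j ∈ e) (hx : ∀ i, 0 ≤ x i)
    (hx1 : ∑ i ∈ S, x i = 1) (hδ : ∀ i, x i ≤ δ)
    (hblock : ∀ U ⊆ 𝓔, #U ≤ t → ∀ i ∈ S, ∑ u ∈ blocked 𝓔 U S i, x u ≤ 1 / 4)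
    (hbig : ∀ a : ℕ, 1 / 2 ≤ (a + 1) * δ → 3 * k * a + t * k ^ 2 < a ^ 2) (hS : t ≤ #S)
    (hL : IsBergeList 𝓔 L) (hLS : ∀ u ∈ L, u ∈ S) (hLt : L.length < t) :
    ∃ L' : List V, IsBergeList 𝓔 L' ∧ (∀ u ∈ L', u ∈ S) ∧ L'.length = L.length + 1 := by
  have hn := hL.1
  obtain ⟨f, T, hf, hc, hT⟩ := hL.exists_card_le
  set U := T.image f with hUdef
  have hU : U ⊆ 𝓔 := image_subset_iff.2 hf.mem
  have hUt : #U ≤ t := card_image_le.trans (hT.trans hLt.le)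
  have hLc : #L.toFinset = L.length := List.toFinset_card_of_nodup hn
  obtain ⟨w, hwS, hwL⟩ : ∃ w ∈ S, w ∉ L := by
    by_contra! hall
    have := card_le_card (s := S) (t := L.toFinset) fun u hu => List.mem_toFinset.2 (hall u hu)
    omega
  rcases hL0 : L with _ | ⟨z, L₀⟩
  · refine ⟨[w], ⟨by simp, f, T, hf, by simp⟩, by simpa using hwS, by simp⟩
  rw [← hL0]
  have hhead : L.head? = some z := by rw [hL0]; rfl
  have hzS : z ∈ S := hLS z (by simp [hL0])
  have hopen : ∀ {i u : V}, u ∈ S → u ∉ blocked 𝓔 U S i → u ≠ i ∧ ∃ e ∈ 𝓔, e ∉ U ∧ i ∈ e ∧ u ∈ e := by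
    intro i u hu hb
    simp only [blocked, mem_filter, not_and, not_or, not_forall] at hb
    obtain ⟨h1, e, he, h2, h3, h4⟩ := hb hu
    exact ⟨h1, e, he, h4, h2, h3⟩
  -- If the path cannot be extended at `z`, everything off the path is blocked for `z`, hence has
  -- weight at most 1/4.
  by_cases hout : ∃ u ∈ S, u ∉ L ∧ u ∉ blocked 𝓔 U S z
  · obtain ⟨u, huS, huL, hub⟩ := hout
    obtain ⟨-, e, he, heU, hze, hue⟩ := hopen huS hub
    exact ⟨u :: L, hf.isBergeList_cons hc hn hhead huL he heU hze hue,
      by simpa [huS] using hLS, by simp⟩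
  push Not at hout
  set v : ℕ → V := fun i => L.getD i z with hv
  have hvinj : Set.InjOn v (Set.Iio L.length) := by
    intro a ha b hb hab
    simp only [Set.mem_Iio] at ha hb
    simp only [hv, List.getD_eq_getElem _ _ ha, List.getD_eq_getElem _ _ hb] at hab
    exact (hn.getElem_inj_iff).1 hab
  have hvL : ∀ i < L.length, v i ∈ L := fun i hi => by
    simp only [hv, List.getD_eq_getElem _ _ hi, List.getElem_mem]
  -- The last vertex is left out because a cut needs a successor; it accounts for the +1 in `hIbig`.
  set I := {i ∈ range (L.length - 1) | v i ∉ blocked 𝓔 U S w} with hIdef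
  have hIlt : ∀ i ∈ I, i + 1 < L.length := fun i hi => by
    have := mem_range.1 (mem_filter.1 hi).1
    omega
  have hIbig : (1 / 2 : ℝ) ≤ (#I + 1) * δ := by
    have hcovS : S ⊆ blocked 𝓔 U S z ∪ blocked 𝓔 U S w ∪ insert (v (L.length - 1)) (I.image v) := by
      intro u hu
      by_cases huz : u ∈ blocked 𝓔 U S z
      · simp [huz]
      by_cases huw : u ∈ blocked 𝓔 U S w
      · simp [huw]
      refine mem_union_right _ ?_
      have huL : u ∈ L := by
        by_contra h
        exact huz (hout u hu h)
      obtain ⟨i, hi, rfl⟩ := List.getElem_of_mem huL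
      have hvi : v i = L[i] := List.getD_eq_getElem _ _ hi
      rcases eq_or_ne i (L.length - 1) with rfl | hne
      · rw [← hvi]; exact mem_insert_self _ _
      · refine mem_insert_of_mem (mem_image.2 ⟨i, mem_filter.2 ⟨mem_range.2 (by omega), ?_⟩, hvi⟩)
        rwa [hvi]
    have h1 := sum_le_sum_of_subset_of_nonneg (f := x) hcovS fun i _ _ => hx i
    have h2 := sum_union_le_add hx (blocked 𝓔 U S z ∪ blocked 𝓔 U S w)
      (insert (v (L.length - 1)) (I.image v))
    have h3 := sum_union_le_add hx (blocked 𝓔 U S z) (blocked 𝓔 U S w)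
    have h4 := hblock U hU hUt z hzS
    have h5 := hblock U hU hUt w hwS
    have h6 : ∑ i ∈ insert (v (L.length - 1)) (I.image v), x i ≤ (#I + 1) * δ := by
      refine (sum_le_card_nsmul _ _ δ fun i _ => hδ i).trans ?_
      rw [nsmul_eq_mul]
      refine mul_le_mul_of_nonneg_right ?_ ((hx w).trans (hδ w))
      exact_mod_cast (card_insert_le _ _).trans (Nat.add_le_add_right card_image_le 1)
    linarith
  have hIopen : ∀ i, ∃ e, i ∈ I → e ∈ 𝓔 ∧ e ∉ U ∧ w ∈ e ∧ v i ∈ e := by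
    intro i
    by_cases hi : i ∈ I
    · obtain ⟨-, e, he⟩ := hopen (hLS _ (hvL i (by have := hIlt i hi; omega))) (mem_filter.1 hi).2
      exact ⟨e, fun _ => he⟩
    · exact ⟨∅, fun h => absurd h hi⟩
  choose g hg using hIopen
  obtain ⟨i, hi, j, hj, h1, h2, h3, h4⟩ := exists_good_pair hk hU hUt hIlt hvinj
    (fun i hi => (hg i hi).1) (hbig _ hIbig)
  have hij : i ≠ j := fun h => h1 (h ▸ (hg i hi).2.2.2)
  have hgij : g i ≠ g j := fun h => h1 (h ▸ (hg j hj).2.2.2)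
  obtain ⟨e, he, hie, hje⟩ := hcov _ (hLS _ (hvL _ (hIlt i hi))) _ (hLS _ (hvL _ (hIlt j hj)))
    (fun h => hij (by simpa using hvinj (hIlt i hi) (hIlt j hj) h))
  have hei : g i ≠ e := fun h => h2 (h ▸ hje)
  have hej : g j ≠ e := fun h => h3 (h ▸ hie)
  have heU : e ∉ U := fun h => h4 e h hie hje
  -- The facts about i and j derived so far are symmetric, unlike `h1` to `h4`, so i < j may be
  -- assumed.
  clear h1 h2 h3 h4
  wlog hlt : i < j generalizing i j
  · exact this j hj i hi hij.symm hgij.symm hje hie hej hei (by omega)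
  obtain ⟨A, B, C, hABC, hA, hB, hB', hC⟩ := exists_split (z := z) hlt (hIlt j hj)
  refine ⟨A ++ w :: (B.reverse ++ C), ?_, ?_, ?_⟩
  · rw [hABC] at hc hn hwL
    exact hf.isBergeList_splice hc hn hwL hA hB hB' hC (hg i hi).1 (hg j hj).1 he (hg i hi).2.1
      (hg j hj).2.1 heU hgij hei hej (hg i hi).2.2.2 (hg i hi).2.2.1 (hg j hj).2.2.1
      (hg j hj).2.2.2 hie hje
  · intro u hu
    rw [hABC] at hLS
    simp only [List.mem_append, List.mem_cons, List.mem_reverse] at hu hLS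
    rcases hu with hu | rfl | hu | hu
    · exact hLS u (Or.inl (Or.inl hu))
    · exact hwS
    · exact hLS u (Or.inl (Or.inr hu))
    · exact hLS u (Or.inr hu)
  · rw [hABC]
    simp only [List.length_append, List.length_cons, List.length_reverse]
    omega

end BergeList

/-- The falling factorial is at least (N - k)^k, and Bernoulli's inequality bounds (1 - k/N)^k from
below. -/
theorem one_sub_le_factorial_mul_choose_div {k N : ℕ} (hk : 1 ≤ k) (hN : k ≤ N) :
    1 - (k : ℝ) ^ 2 / N ≤ k.factorial * (N.choose k / (N : ℝ) ^ k) := by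
  have hN0 : (0 : ℝ) < N := Nat.cast_pos.2 (by omega)
  have h1 : ((N - k : ℕ) : ℝ) ^ k ≤ k.factorial * N.choose k := by
    rw [← Nat.cast_mul, ← Nat.descFactorial_eq_factorial_mul_choose, ← Nat.cast_pow]
    exact_mod_cast (Nat.pow_le_pow_left (by omega) k).trans (Nat.pow_sub_le_descFactorial N k)
  have h2 := one_add_mul_le_pow (a := -((k : ℝ) / N)) (by
    have : (k : ℝ) / N ≤ 1 := (div_le_one hN0).2 (by exact_mod_cast hN)
    linarith) k
  calc 1 - (k : ℝ) ^ 2 / N = 1 + k * -((k : ℝ) / N) := by ring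
    _ ≤ (1 + -((k : ℝ) / N)) ^ k := h2
    _ = ((N - k : ℕ) : ℝ) ^ k / (N : ℝ) ^ k := by
      rw [Nat.cast_sub hN, ← div_pow]
      congr 1
      field_simp
      ring
    _ ≤ k.factorial * N.choose k / (N : ℝ) ^ k := by gcongr
    _ = _ := by ring

/-! ### Spread of an optimal weight, and the long path in its support -/

section Support

variable {V : Type*} [Fintype V] [DecidableEq V] {𝓔 : Finset (Finset V)} {x : V → ℝ} {k N : ℕ}

/-- When the form is nearly as large as possible, the link of every vertex of the support is nearly
complete. -/
theorem IsOptimal.sum_mul_one_sub_le (hx : IsOptimal 𝓔 x) (hk2 : 2 ≤ k) (hk : ∀ e ∈ 𝓔, #e = k)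
    (hN : k ≤ N) (hlam : N.choose k / (N : ℝ) ^ k ≤ familyForm 𝓔 x) {i : V} (hi : 0 < x i) :
    ∑ u, x u * (1 - (k - 2).factorial *
      familyForm ((𝓔.memberSubfamily i).memberSubfamily u) x) ≤ (k : ℝ) ^ 2 / N := by
  have h1 := sum_mul_familyForm_memberSubfamily (card_of_mem_memberSubfamily hk i) x
  rw [hx.deriv_eq hk hi] at h1
  have h2 := one_sub_le_factorial_mul_choose_div (by omega) hN
  have h3 : (k.factorial : ℝ) = (k - 2).factorial * (((k - 1 : ℕ) : ℝ) * k) := by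
    obtain ⟨r, rfl⟩ := Nat.exists_eq_add_of_le' hk2
    rw [Nat.add_sub_cancel, Nat.factorial_succ, Nat.factorial_succ]
    push_cast [show r + 2 - 1 = r + 1 from rfl]
    ring
  have h4 : ∑ u, x u * (1 - (k - 2).factorial *
      familyForm ((𝓔.memberSubfamily i).memberSubfamily u) x) =
      1 - (k - 2).factorial * (((k - 1 : ℕ) : ℝ) * (k * familyForm 𝓔 x)) := by
    simp_rw [mul_sub, mul_one]
    rw [← h1, mul_sum, sum_sub_distrib, hx.sum_eq]
    exact congrArg _ (sum_congr rfl fun u _ => by ring)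
  have h5 : (k.factorial : ℝ) * (N.choose k / (N : ℝ) ^ k) ≤ k.factorial * familyForm 𝓔 x := by
    gcongr
  rw [h4]
  have h6 : ((k - 2).factorial : ℝ) * (((k - 1 : ℕ) : ℝ) * (k * familyForm 𝓔 x)) =
      k.factorial * familyForm 𝓔 x := by rw [h3]; ring
  linarith

theorem IsOptimal.mul_one_sub_nonneg (hx : IsOptimal 𝓔 x) (hk : ∀ e ∈ 𝓔, #e = k) (i u : V) :
    0 ≤ x u * (1 - (k - 2).factorial *
      familyForm ((𝓔.memberSubfamily i).memberSubfamily u) x) := by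
  have := factorial_mul_familyForm_le_one hx.nonneg hx.sum_eq (k - 2)
    ((𝓔.memberSubfamily i).memberSubfamily u) (card_of_mem_memberSubfamily
      (card_of_mem_memberSubfamily hk i) u)
  exact mul_nonneg (hx.nonneg u) (by linarith)

/-- In the nonnegative sum of `IsOptimal.sum_mul_one_sub_le`, the term u = i is `x i` itself, as the
repeated link at i is empty. -/
theorem IsOptimal.le_div (hx : IsOptimal 𝓔 x) (hk2 : 2 ≤ k) (hk : ∀ e ∈ 𝓔, #e = k)
    (hN : k ≤ N) (hlam : N.choose k / (N : ℝ) ^ k ≤ familyForm 𝓔 x) (i : V) :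
    x i ≤ (k : ℝ) ^ 2 / N := by
  rcases (hx.nonneg i).eq_or_lt with hi | hi
  · rw [← hi]; positivity
  refine le_trans ?_ (hx.sum_mul_one_sub_le hk2 hk hN hlam hi)
  refine le_trans (le_of_eq ?_) (single_le_sum (fun u _ => hx.mul_one_sub_nonneg hk i u)
    (mem_univ i))
  rw [memberSubfamily_memberSubfamily]
  simp [familyForm]

/-- At a blocked u the codegree D with i comes from U alone. Split x_u into x_u(1 - cD) and c·x_u·D:
near-completeness bounds the first part, Euler's identity in the link of i in U the second. With k ≥
3 each edge of that link contributes at most δ^(k-1) ≤ δ², so t ≈ N edges contribute O(1/N); for k =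
2 the bound tδ would not be small. -/
theorem IsOptimal.sum_blocked_le (hx : IsOptimal 𝓔 x) (hk3 : 3 ≤ k) (hk : ∀ e ∈ 𝓔, #e = k)
    (hN : k ^ 2 ≤ N) (hlam : N.choose k / (N : ℝ) ^ k ≤ familyForm 𝓔 x) {i : V} (hi : 0 < x i)
    {U : Finset (Finset V)} (hU : U ⊆ 𝓔) {t : ℕ} (hUt : #U ≤ t) (S : Finset V) :
    ∑ u ∈ blocked 𝓔 U S i, x u ≤
      (k : ℝ) ^ 2 / N + (k - 1).factorial * (t * ((k : ℝ) ^ 2 / N) ^ 2) := by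
  have hkN : k ≤ N := by nlinarith
  have hN0 : (0 : ℝ) < N := Nat.cast_pos.2 (by omega)
  set δ : ℝ := (k : ℝ) ^ 2 / N
  have hδ0 : 0 ≤ δ := by positivity
  have hδ1 : δ ≤ 1 := (div_le_one hN0).2 (by exact_mod_cast hN)
  set c : ℝ := ((k - 2).factorial : ℝ)
  set D : V → ℝ := fun u => familyForm ((𝓔.memberSubfamily i).memberSubfamily u) x with hD
  set DU : V → ℝ := fun u => familyForm ((U.memberSubfamily i).memberSubfamily u) x with hDU
  have hle : ∀ u ∈ blocked 𝓔 U S i, D u ≤ DU u := by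
    intro u hu
    refine familyForm_mono hx.nonneg fun s hs => ?_
    simp only [mem_memberSubfamily, mem_insert, not_or] at hs ⊢
    refine ⟨⟨?_, hs.1.2⟩, hs.2⟩
    simp only [blocked, mem_filter] at hu
    rcases hu.2 with h | h
    · exact absurd h.symm hs.1.2.1
    · exact h _ hs.1.1 (by simp) (by simp)
  have h1 : ∑ u ∈ blocked 𝓔 U S i, x u * (1 - c * D u) ≤ δ :=
    (sum_le_sum_of_subset_of_nonneg (subset_univ _) fun u _ _ =>
      hx.mul_one_sub_nonneg hk i u).trans (hx.sum_mul_one_sub_le (by omega) hk hkN hlam hi)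
  have h2 : ∑ u ∈ blocked 𝓔 U S i, x u * D u ≤ ∑ u, x u * DU u :=
    (sum_le_sum fun u hu => mul_le_mul_of_nonneg_left (hle u hu) (hx.nonneg u)).trans
      (sum_le_sum_of_subset_of_nonneg (subset_univ _) fun u _ _ =>
        mul_nonneg (hx.nonneg u) (familyForm_nonneg hx.nonneg))
  have hcU := card_of_mem_memberSubfamily (fun e he => hk e (hU he)) i
  have h3 : ∑ u, x u * DU u = (k - 1 : ℕ) * familyForm (U.memberSubfamily i) x :=
    sum_mul_familyForm_memberSubfamily hcU x
  have h4 : familyForm (U.memberSubfamily i) x ≤ t * δ ^ 2 := by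
    refine (familyForm_le_card_mul_pow hx.nonneg
      (fun i => hx.le_div (by omega) hk hkN hlam i) hcU).trans ?_
    refine mul_le_mul ?_ (pow_le_pow_of_le_one hδ0 hδ1 (by omega)) (by positivity) (by positivity)
    exact_mod_cast card_image_le.trans ((card_filter_le _ _).trans hUt)
  have h5 : ((k - 1).factorial : ℝ) = c * (k - 1 : ℕ) := by
    obtain ⟨r, rfl⟩ := Nat.exists_eq_add_of_le' hk3
    rw [show r + 3 - 1 = r + 2 from rfl, Nat.factorial_succ, Nat.cast_mul, mul_comm]
    rfl
  have h6 : ∑ u ∈ blocked 𝓔 U S i, x u =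
      ∑ u ∈ blocked 𝓔 U S i, x u * (1 - c * D u) + c * ∑ u ∈ blocked 𝓔 U S i, x u * D u := by
    rw [mul_sum, ← sum_add_distrib]
    exact sum_congr rfl fun u _ => by ring
  rw [h6, h5, mul_assoc]
  refine add_le_add h1 (mul_le_mul_of_nonneg_left ?_ (by positivity))
  rw [h3] at h2
  exact h2.trans (mul_le_mul_of_nonneg_left h4 (by positivity))

/-- A family of pairs covering all pairs of `S` has a Berge path through all of `S`. -/
theorem exists_isBergeList_of_card_two {V : Type*} [DecidableEq V] {𝓔 : Finset (Finset V)} (hk : ∀ e ∈ 𝓔, #e = 2) {S : Finset V}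
    (hcov : ∀ i ∈ S, ∀ j ∈ S, i ≠ j → ∃ e ∈ 𝓔, i ∈ e ∧ j ∈ e) : IsBergeList 𝓔 S.toList := by
  have hpair : ∀ i ∈ S, ∀ j ∈ S, i ≠ j → {i, j} ∈ 𝓔 := by
    intro i hi j hj hij
    obtain ⟨e, he, hie, hje⟩ := hcov i hi j hj hij
    rwa [eq_of_subset_of_card_le (s := {i, j}) (t := e)
      (insert_subset hie (singleton_subset_iff.2 hje)) (by rw [hk e he, card_pair hij])]
  refine ⟨S.nodup_toList, Sym2.toFinset, {p ∈ S.sym2 | ¬ p.IsDiag}, ⟨?_, ?_, ?_⟩, ?_⟩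
  · intro p _ q _ h
    refine Sym2.ext fun v => ?_
    rw [← Sym2.mem_toFinset, h, Sym2.mem_toFinset]
  · intro p
    induction p with | h a b =>
    intro hp
    simp only [mem_filter, mk_mem_sym2_iff, Sym2.mk_isDiag_iff] at hp
    rw [Sym2.toFinset_mk_eq]
    exact hpair a hp.1.1 b hp.1.2 hp.2
  · intro p _ v hv
    exact Sym2.mem_toFinset.2 hv
  · have h := S.nodup_toList.pairwise_of_forall_ne (r := fun a b => s(a, b) ∈
      ({p ∈ S.sym2 | ¬ p.IsDiag} : Finset (Sym2 V))) (fun a ha b hb hab => by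
        simpa [hab] using And.intro ha hb)
    exact h.isChain

theorem exists_isBergeList_of_lt (hx : IsOptimal 𝓔 x)
    (hmin : ∀ y, IsOptimal 𝓔 y → #{i | 0 < x i} ≤ #{i | 0 < y i}) (hk2 : 2 ≤ k)
    (hk : ∀ e ∈ 𝓔, #e = k) (hN₁ : 4 * (k ^ 2 + 2 * (k - 1).factorial * k ^ 4) ≤ N)
    (hN₂ : 2 * k ^ 2 * (8 * k ^ 4 + 3 * k + 3) ≤ N)
    (hlam : N.choose k / (N : ℝ) ^ k < familyForm 𝓔 x) :
    ∃ L, IsBergeList 𝓔 L ∧ N + 1 ≤ L.length := by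
  set S : Finset V := {i | 0 < x i} with hSdef
  have hS : ∀ i, i ∈ S ↔ 0 < x i := fun i => by simp [hSdef]
  have hkN : k ^ 2 ≤ N :=
    le_trans (by nlinarith [Nat.zero_le (2 * (k - 1).factorial * k ^ 4)]) hN₁
  have hkN' : k ≤ N := (Nat.le_self_pow two_ne_zero k).trans hkN
  have hN0 : (0 : ℝ) < N := Nat.cast_pos.2 (by omega)
  have hx1 : ∑ i ∈ S, x i = 1 := by
    rw [← hx.sum_eq]
    refine sum_subset (subset_univ _) fun i _ hi => ?_
    rw [hS, not_lt] at hi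
    exact hi.antisymm (hx.nonneg i)
  have hcov : ∀ i ∈ S, ∀ j ∈ S, i ≠ j → ∃ e ∈ 𝓔, i ∈ e ∧ j ∈ e := fun i hi j hj hij =>
    hx.exists_mem_of_minimal hmin hij ((hS i).1 hi) ((hS j).1 hj)
  have hScard : N + 1 ≤ #S := by
    by_contra! hlt
    have hkS : k ≤ #S := by
      have hpos : 0 < familyForm 𝓔 x := lt_of_le_of_lt (by positivity) hlam
      obtain ⟨e, he, hpe⟩ := exists_ne_zero_of_sum_ne_zero hpos.ne'
      rw [← hk e he]
      exact card_le_card fun i hi =>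
        (hS i).2 ((hx.nonneg i).lt_of_ne' (prod_ne_zero_iff.1 hpe i hi))
    have h1 : familyForm 𝓔 x ≤ familyForm (powersetCard k S) x := by
      rw [familyForm, ← sum_filter_ne_zero]
      refine familyForm_mono hx.nonneg fun e he => ?_
      obtain ⟨he, hpe⟩ := mem_filter.1 he
      exact mem_powersetCard.2 ⟨fun i hi =>
        (hS i).2 ((hx.nonneg i).lt_of_ne' (prod_ne_zero_iff.1 hpe i hi)), hk e he⟩
    -- Dummy vertices of weight 0 pad the support to exactly N vertices, so Maclaurin applies with N
    -- directly.
    have hsub : S.map ⟨Sum.inl, Sum.inl_injective⟩ ⊆ (univ : Finset (V ⊕ Fin N)) := subset_univ _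
    obtain ⟨T, hST, -, hT⟩ := exists_subsuperset_card_eq hsub
      (n := N) (by rw [card_map]; omega) (by simp)
    set y : V ⊕ Fin N → ℝ := Sum.elim x 0
    have hy : ∀ i, 0 ≤ y i := by
      rintro (i | i)
      · exact hx.nonneg i
      · exact le_rfl
    have hy1 : ∑ i ∈ T, y i = 1 := by
      rw [← hx1, ← sum_subset hST, sum_map]
      · rfl
      · rintro (i | i) - hi
        · have : i ∉ S := fun h => hi (mem_map_of_mem _ h)
          rw [hS, not_lt] at this
          exact this.antisymm (hx.nonneg i)
        · rfl
    have h2 := familyForm_powersetCard_le hk2 (hkN'.trans_eq hT.symm) hy hy1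
    have h3 : familyForm (powersetCard k S) x ≤ familyForm (powersetCard k T) y := by
      refine le_trans (le_of_eq ?_) (familyForm_mono hy (powersetCard_mono hST))
      rw [powersetCard_map, familyForm, familyForm, sum_map]
      refine sum_congr rfl fun e _ => ?_
      simp [mapEmbedding, y]
    rw [hT] at h2
    linarith
  rcases hk2.eq_or_lt with rfl | hk3
  · exact ⟨S.toList, exists_isBergeList_of_card_two hk hcov, by rwa [length_toList]⟩
  set δ : ℝ := (k : ℝ) ^ 2 / N with hδ
  have hblock : ∀ U ⊆ 𝓔, #U ≤ N + 1 → ∀ i ∈ S, ∑ u ∈ blocked 𝓔 U S i, x u ≤ 1 / 4 := by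
    intro U hU hUt i hi
    refine (hx.sum_blocked_le hk3 hk hkN hlam.le ((hS i).1 hi) hU hUt S).trans ?_
    have hN₁' : 4 * ((k : ℝ) ^ 2 + 2 * (k - 1).factorial * k ^ 4) ≤ N := by exact_mod_cast hN₁
    have h1 : (((N + 1 : ℕ) : ℝ)) ≤ 2 * N := by
      have : (1 : ℝ) ≤ N := by exact_mod_cast (show 1 ≤ N by omega)
      push_cast; linarith
    calc (k : ℝ) ^ 2 / N + (k - 1).factorial * (((N + 1 : ℕ) : ℝ) * ((k : ℝ) ^ 2 / N) ^ 2)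
        ≤ (k : ℝ) ^ 2 / N + (k - 1).factorial * (2 * N * ((k : ℝ) ^ 2 / N) ^ 2) := by gcongr
      _ = ((k : ℝ) ^ 2 + 2 * (k - 1).factorial * k ^ 4) / N := by field_simp
      _ ≤ 1 / 4 := by
        rw [div_le_iff₀ hN0]
        linarith
  -- The hypothesis forces a + 1 ≥ N/(2k²), so the left side is linear in a; `hN₂` makes a large
  -- enough for a² to win.
  have hbig : ∀ a : ℕ, 1 / 2 ≤ (a + 1) * δ → 3 * k * a + (N + 1) * k ^ 2 < a ^ 2 := by
    intro a ha
    have h1 : N ≤ 2 * k ^ 2 * (a + 1) := by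
      rw [hδ, mul_div_assoc', le_div_iff₀ hN0] at ha
      have : (N : ℝ) ≤ 2 * k ^ 2 * (a + 1) := by linarith
      exact_mod_cast this
    have hk0 : 0 < 2 * k ^ 2 := by positivity
    have h2 : 8 * k ^ 4 + 3 * k + 2 ≤ a := by
      have := Nat.le_of_mul_le_mul_left (hN₂.trans h1) hk0
      omega
    have h3 : (N + 1) * k ^ 2 ≤ 8 * k ^ 4 * a := by
      calc (N + 1) * k ^ 2 ≤ (2 * N) * k ^ 2 := Nat.mul_le_mul_right _ (by omega)
        _ ≤ 2 * (2 * k ^ 2 * (a + 1)) * k ^ 2 := by gcongr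
        _ = 4 * k ^ 4 * (a + 1) := by ring
        _ ≤ 4 * k ^ 4 * (2 * a) := Nat.mul_le_mul_left _ (by omega)
        _ = _ := by ring
    calc 3 * k * a + (N + 1) * k ^ 2 ≤ 3 * k * a + 8 * k ^ 4 * a := by omega
      _ < (8 * k ^ 4 + 3 * k + 2) * a := by nlinarith
      _ ≤ a ^ 2 := by rw [pow_two]; exact Nat.mul_le_mul_right _ h2
  have hlen : ∀ m ≤ N + 1, ∃ L, IsBergeList 𝓔 L ∧ (∀ u ∈ L, u ∈ S) ∧ L.length = m := by
    intro m
    induction m with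
    | zero => exact fun _ => ⟨[], ⟨by simp, fun _ => ∅, ∅, ⟨by simp, by simp, by simp⟩, by simp⟩,
        by simp, rfl⟩
    | succ m ih =>
      intro hm
      obtain ⟨L, hL, hLS, rfl⟩ := ih (by omega)
      exact hL.exists_extension hk hcov hx.nonneg hx1
        (fun i => hx.le_div hk2 hk hkN' hlam.le i) hblock hbig hScard hLS (by omega)
  obtain ⟨L, hL, -, hLm⟩ := hlen (N + 1) le_rfl
  exact ⟨L, hL, hLm.ge⟩

end Support

/-! ### Back to hypergraphs: Lagrangians and the extremal example -/

namespace Hypergraph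

theorem hasBergePath_of_isBergeList {V : Type*} {H : Hypergraph V} (hV : V(H) = Set.univ)
    {𝓔 : Finset (Finset V)} (h𝓔 : ∀ e ∈ 𝓔, (e : Set V) ∈ E(H)) {L : List V}
    (hL : IsBergeList 𝓔 L) {t : ℕ} (ht : t ≤ L.length) : H.HasBergePath t := by
  obtain ⟨hn, f, T, hf, hc⟩ := hL
  rw [List.isChain_iff_getElem] at hc
  have hT : ∀ i : Fin (t - 1), s(L[i.1], L[i.1 + 1]) ∈ T := fun i => hc i (by omega)
  refine ⟨fun i => L[i.1], fun i => f s(L[i.1], L[i.1 + 1]), ?_, ?_, ?_, ?_, ?_⟩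
  · intro i j h
    exact Fin.ext (hn.getElem_inj_iff.1 h)
  · intro i j h
    have := hf.injOn (hT i) (hT j) (coe_injective h)
    simp only [Sym2.eq_iff, hn.getElem_inj_iff] at this
    exact Fin.ext (by omega)
  · intro i
    simp [hV]
  · exact fun i => h𝓔 _ (hf.mem _ (hT i))
  · intro i v hv
    refine hf.sub _ (hT i) v ?_
    simpa using hv

theorem polyForm_eq_familyForm {V : Type*} [Fintype V] (H : Hypergraph V) :
    ∃ 𝓔 : Finset (Finset V), (∀ e, e ∈ 𝓔 ↔ (e : Set V) ∈ E(H)) ∧ H.polyForm = familyForm 𝓔 := by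
  classical
  refine ⟨univ.filter fun e : Finset V => (e : Set V) ∈ E(H), by simp, funext fun x => ?_⟩
  -- The sum in `polyForm` unfolds to one over images of finsets in `Set V`; injectivity of the
  -- coercion reindexes it.
  rw [polyForm, familyForm, bind_pure_comp, fmap_def, filter_image]
  refine (sum_image (g := fun e : Finset V => (e : Set V)) coe_injective.injOn).trans ?_
  exact sum_congr (by ext; simp) fun e _ => by simp

theorem polyForm_le_lagrangian {V : Type*} [Fintype V] [Nonempty V] (H : Hypergraph V)
    {x : V → ℝ} (hx : ∀ i, 0 ≤ x i) (h1 : ∑ i, x i = 1) : H.polyForm x ≤ H.lagrangian :=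
  H.isGreatest_lagrangian.2 ⟨x, ⟨hx, by simpa only [abs_of_nonneg (hx _)] using h1⟩, rfl⟩

theorem exists_polyForm_eq_lagrangian {V : Type*} [Fintype V] [Nonempty V] (H : Hypergraph V) :
    ∃ x : V → ℝ, (∀ i, 0 ≤ x i) ∧ ∑ i, x i = 1 ∧ H.polyForm x = H.lagrangian := by
  obtain ⟨x, ⟨hx, h1⟩, h⟩ := H.isGreatest_lagrangian.1
  exact ⟨x, hx, by simpa only [abs_of_nonneg (hx _)] using h1, h⟩

theorem lagrangian_completeUniform {k m : ℕ} (hk : 2 ≤ k) (hm : k ≤ m) :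
    (completeUniform (Fin m) k).lagrangian = m.choose k / (m : ℝ) ^ k := by
  have : Nonempty (Fin m) := ⟨⟨0, by omega⟩⟩
  obtain ⟨𝓔, h𝓔, hform⟩ := (completeUniform (Fin m) k).polyForm_eq_familyForm
  have hE : 𝓔 = powersetCard k univ := by
    ext e
    simp [h𝓔, completeUniform, mem_powersetCard]
  have hm0 : (m : ℝ) ≠ 0 := Nat.cast_ne_zero.2 (by omega)
  refine le_antisymm ?_ ?_
  · obtain ⟨x, hx, h1, h⟩ := (completeUniform (Fin m) k).exists_polyForm_eq_lagrangian
    rw [← h, hform, hE]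
    simpa using familyForm_powersetCard_univ_le hk (by simpa using hm) hx h1
  · refine le_trans (le_of_eq ?_) (polyForm_le_lagrangian _ (x := fun _ => (m : ℝ)⁻¹)
      (fun _ => by positivity) (by simp [hm0]))
    rw [hform, hE, familyForm_powersetCard_const, card_fin, inv_pow, div_eq_mul_inv]

/-- The `k`-subsets of `T`, as a hypergraph on the whole vertex type. -/
def uniformOn {V : Type*} (T : Finset V) (k : ℕ) : Hypergraph V where
  vertexSet := Set.univ
  edgeSet := {e | e ⊆ T ∧ e.encard = k}
  subset_vertexSet_of_mem_edgeSet' := fun _ _ => Set.subset_univ _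

theorem not_hasBergePath_uniformOn {V : Type*} {T : Finset V} {k t : ℕ} (ht : 2 ≤ t)
    (hT : #T < t) : ¬ (uniformOn T k).HasBergePath t := by
  rintro ⟨v, h, hv, -, -, hh, hvh⟩
  have hvT : ∀ i, v i ∈ T := by
    intro i
    by_cases hi : i.1 < t - 1
    · exact (hh ⟨i, hi⟩).1 (hvh ⟨i, hi⟩ (by simp))
    -- The final vertex starts no edge of the path but ends the last one, with index t - 2.
    · have : i = ⟨(⟨t - 2, by omega⟩ : Fin (t - 1)).1 + 1, by simp; omega⟩ :=
        Fin.ext (by simp; omega)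
      rw [this]
      exact (hh ⟨t - 2, by omega⟩).1 (hvh ⟨t - 2, by omega⟩ (by simp))
  have := card_le_card_of_injOn (s := univ) (t := T) v (fun i _ => hvT i) hv.injOn
  rw [card_fin] at this
  omega

theorem le_lagrangian_uniformOn {V : Type*} [Fintype V] {T : Finset V} {k : ℕ} (hT : 0 < #T) :
    (#T).choose k / (#T : ℝ) ^ k ≤ (uniformOn T k).lagrangian := by
  classical
  have : Nonempty V := ⟨(card_pos.1 hT).choose⟩
  have hT0 : (#T : ℝ) ≠ 0 := Nat.cast_ne_zero.2 hT.ne'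
  obtain ⟨𝓔, h𝓔, hform⟩ := (uniformOn T k).polyForm_eq_familyForm
  have hE : 𝓔 = powersetCard k T := by
    ext e
    simp [h𝓔, uniformOn, mem_powersetCard]
  refine le_trans (le_of_eq ?_) (polyForm_le_lagrangian _
    (x := fun i => if i ∈ T then (#T : ℝ)⁻¹ else 0) (fun i => ?_) ?_)
  · rw [hform, hE, familyForm_congr (y := fun _ => (#T : ℝ)⁻¹), familyForm_powersetCard_const,
      inv_pow, div_eq_mul_inv]
    intro e he i hi
    rw [if_pos ((mem_powersetCard.1 he).1 hi)]
  · split_ifs <;> positivity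
  · rw [sum_ite_mem, univ_inter, sum_const, nsmul_eq_mul, mul_inv_cancel₀ hT0]

theorem lagrangian_le_of_not_hasBergePath {V : Type*} [Fintype V] [Nonempty V] {H : Hypergraph V}
    {k N : ℕ} (hk2 : 2 ≤ k) (hN₁ : 4 * (k ^ 2 + 2 * (k - 1).factorial * k ^ 4) ≤ N)
    (hN₂ : 2 * k ^ 2 * (8 * k ^ 4 + 3 * k + 3) ≤ N) (hV : V(H) = Set.univ) (hH : H.IsUniform k)
    (hP : ¬ H.HasBergePath (N + 1)) : H.lagrangian ≤ N.choose k / (N : ℝ) ^ k := by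
  classical
  obtain ⟨𝓔, h𝓔, hform⟩ := H.polyForm_eq_familyForm
  have hk : ∀ e ∈ 𝓔, #e = k := fun e he => by
    have := hH _ ((h𝓔 e).1 he)
    rwa [Set.encard_coe_eq_coe_finsetCard, Nat.cast_inj] at this
  obtain ⟨x, hx, hmin⟩ := exists_isOptimal 𝓔
  obtain ⟨y, hy, hy1, hyl⟩ := H.exists_polyForm_eq_lagrangian
  rw [← hyl, hform]
  refine (hx.le y hy hy1).trans (not_lt.1 fun hlt => hP ?_)
  obtain ⟨L, hL, hLN⟩ := exists_isBergeList_of_lt hx hmin hk2 hk hN₁ hN₂ hlt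
  exact hasBergePath_of_isBergeList hV (fun e he => (h𝓔 e).1 he) hL hLN

end Hypergraph

theorem corollary1p7 (k : ℕ) (hk : 2 ≤ k) :
    ∃ t₀ : ℕ, ∀ t : ℕ, t₀ ≤ t →
      (Hypergraph.completeUniform (Fin (t - 1)) k).lagrangian =
        ((t - 1).choose k : ℝ) / ((t - 1 : ℕ) : ℝ) ^ k ∧
      ∀ n : ℕ, t - 1 ≤ n → ∀ (V : Type*) [Fintype V], Fintype.card V = n →
        (∀ H : Hypergraph V, V(H) = Set.univ → H.IsUniform k → ¬ H.HasBergePath t →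
          H.lagrangian ≤ (Hypergraph.completeUniform (Fin (t - 1)) k).lagrangian) ∧
        (∃ H : Hypergraph V, V(H) = Set.univ ∧ H.IsUniform k ∧ ¬ H.HasBergePath t ∧
          H.lagrangian = (Hypergraph.completeUniform (Fin (t - 1)) k).lagrangian) := by
  refine ⟨4 * (k ^ 2 + 2 * (k - 1).factorial * k ^ 4) +
    2 * k ^ 2 * (8 * k ^ 4 + 3 * k + 3) + 1, fun t ht => ?_⟩
  obtain ⟨N, rfl⟩ : ∃ N, t = N + 1 := ⟨t - 1, by omega⟩
  rw [Nat.add_sub_cancel]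
  have hN₁ : 4 * (k ^ 2 + 2 * (k - 1).factorial * k ^ 4) ≤ N := by omega
  have hN₂ : 2 * k ^ 2 * (8 * k ^ 4 + 3 * k + 3) ≤ N := by omega
  have hkN : k ≤ N := (Nat.le_self_pow two_ne_zero k).trans
    (le_trans (by nlinarith [Nat.zero_le (2 * (k - 1).factorial * k ^ 4)]) hN₁)
  have hK := Hypergraph.lagrangian_completeUniform hk hkN
  refine ⟨hK, fun n hn V _ hV => ?_⟩
  simp only [hK]
  have : Nonempty V := Fintype.card_pos_iff.1 (by omega)
  have hle : ∀ H : Hypergraph V, V(H) = Set.univ → H.IsUniform k → ¬ H.HasBergePath (N + 1) →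
      H.lagrangian ≤ N.choose k / (N : ℝ) ^ k := fun H h1 h2 h3 =>
    Hypergraph.lagrangian_le_of_not_hasBergePath hk hN₁ hN₂ h1 h2 h3
  refine ⟨hle, ?_⟩
  -- Extremal example: all k-subsets of t - 1 fixed vertices. A Berge path would need t vertices
  -- inside T, and the upper bound just proved applies to it.
  obtain ⟨T, -, hT⟩ := exists_subset_card_eq (s := (univ : Finset V)) (n := N)
    (by rw [card_univ]; omega)
  have hP : ¬ (Hypergraph.uniformOn T k).HasBergePath (N + 1) :=
    Hypergraph.not_hasBergePath_uniformOn (by omega) (by omega)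
  refine ⟨Hypergraph.uniformOn T k, rfl, fun e he => he.2, hP, le_antisymm
    (hle _ rfl (fun e he => he.2) hP) ?_⟩
  have := Hypergraph.le_lagrangian_uniformOn (T := T) (k := k) (by omega)
  rwa [hT] at this
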